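/- For a finite simple graph $G=(V,E)$ and a map $p:V\to\mathbb{R}^d$, let $R(G,p)$ be the $|E|\times d|V|$ rigidity matrix, whose row for an edge $uv$ has $p(u)-p(v)$ in the $d$ columns of $u$, $p(v)-p(u)$ in the $d$ columns of $v$, and zeros elsewhere. Call $p$ generic if its $d|V|$ coordinates are algebraically independent over $\mathbb{Q}$, and call $G$ $\mathcal{R}_d$-independent if the rows of $R(G,p)$ are linearly independent for some (equivalently, every) generic $p:V\to\mathbb{R}^d$. A graph $G'$ is obtained from $G$ by - a $d$-dimensional $X$-replacement if there are edges $uv$ and $xy$ of $G$ with no common vertex such that $G'$ is $G-\{uv,xy\}$ plus one additional vertex $w$ of degree $d+2$ that is adjacent to $u,v,x,y$ (and to $d-2$ further vertices); - a $d$-dimensional $V$-replacement if there are distinct edges $xy$ and $yz$ of $G$ such that $G'$ is $G-\{xy,yz\}$ plus one additional vertex $w$ of degree $d+2$ that is adjacent to $x,y,z$ (and to $d-1$ further vertices). **Corollary.** Let $d\ge 0$, let $G$ be a finite simple graph that is $\mathcal{R}_d$-independent, and let $G'$ be obtained from $G$ by a $(d+1)$-dimensional $X$-replacement or a $(d+1)$-dimensional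 $V$-replacement (so that the new vertex has degree $d+3$). Then $G'$ is $\mathcal{R}_{d+1}$-independent. -/

import Mathlib

/-- A realisation `p : V → ℝᵈ` is generic if its coordinates are algebraically independent
over `ℚ`. -/
def IsGenericRealisation {V : Type*} {d : ℕ} (p : V → EuclideanSpace ℝ (Fin d)) : Prop :=
  AlgebraicIndependent ℚ (fun c : V × Fin d => p c.1 c.2)

open Classical in
/-- The row of the rigidity matrix indexed by the edge `uv`: it has `p u - p v` in the columns of
`u`, `p v - p u` in the columns of `v`, and `0` elsewhere. -/
noncomputable def rigidityRow {V : Type*} {d : ℕ} (p : V → EuclideanSpace ℝ (Fin d)) :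
    Sym2 V → V × Fin d → ℝ :=
  Sym2.lift ⟨fun u v c =>
      if c.1 = u then p u c.2 - p v c.2
      else if c.1 = v then p v c.2 - p u c.2
      else 0, by
    intro u v
    funext c
    by_cases hu : c.1 = u <;> by_cases hv : c.1 = v <;> simp_all⟩

/-- The rigidity matrix `R(G, p)` of a `d`-dimensional framework, with rows indexed by the edges
and `d` columns for every vertex. -/
noncomputable def rigidityMatrix {V : Type*} {d : ℕ} (G : SimpleGraph V)
    (p : V → EuclideanSpace ℝ (Fin d)) : Matrix G.edgeSet (V × Fin d) ℝ :=
  Matrix.of fun e c => rigidityRow p (e : Sym2 V) c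

/-- Independence of a set `F` of edges of `G` in the `d`-dimensional generic rigidity matroid
`R_d(G)`: the rows of `R(G, p)` labelled by `F` are linearly independent for some generic `p`. -/
def RigidityMatroidIndep {V : Type*} (d : ℕ) (G : SimpleGraph V) (F : Set G.edgeSet) : Prop :=
  ∃ p : V → EuclideanSpace ℝ (Fin d), IsGenericRealisation p ∧
    LinearIndepOn ℝ (rigidityMatrix G p).row F

/-- `G` is `R_d`-independent: its whole edge set is independent in `R_d(G)` (for a finite graph,
the rank of `R_d(G)` is the number of edges of `G`). -/
def IsRigidityIndependent {V : Type*} (d : ℕ) (G : SimpleGraph V) : Prop :=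
  RigidityMatroidIndep d G Set.univ

/-- `G'` arises, up to the naming `φ` of the old vertices, from the graph `G - D` (the edges in `D`
are deleted, all vertices are kept) by adding one new vertex `w`, of degree `k`, which is adjacent
to all vertices in `S` (and to arbitrary other old vertices). -/
def IsVertexAdditionAfterDeletion {V V' : Type*} (G : SimpleGraph V) (G' : SimpleGraph V')
    (D : Set (Sym2 V)) (S : Set V) (k : ℕ) : Prop :=
  ∃ (φ : V ↪ V') (w : V'), Set.range φ = {w}ᶜ ∧
    (∀ a b : V, G'.Adj (φ a) (φ b) ↔ (G.deleteEdges D).Adj a b) ∧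
    (∀ s ∈ S, G'.Adj w (φ s)) ∧
    (G'.neighborSet w).ncard = k

/-- `G'` is obtained from `G` by a `d`-dimensional X-replacement on two edges `uv` and `xy` of `G`
without a common vertex. -/
def IsXReplacement {V V' : Type*} (d : ℕ) (G : SimpleGraph V) (G' : SimpleGraph V') : Prop :=
  ∃ u v x y : V, G.Adj u v ∧ G.Adj x y ∧ u ≠ x ∧ u ≠ y ∧ v ≠ x ∧ v ≠ y ∧
    IsVertexAdditionAfterDeletion G G' {s(u, v), s(x, y)} {u, v, x, y} (d + 2)

/-- `G'` is obtained from `G` by a `d`-dimensional V-replacement on two distinct edges `xy` and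
`yz` of `G` with the common vertex `y`. -/
def IsVReplacement {V V' : Type*} (d : ℕ) (G : SimpleGraph V) (G' : SimpleGraph V') : Prop :=
  ∃ x y z : V, G.Adj x y ∧ G.Adj y z ∧ x ≠ z ∧
    IsVertexAdditionAfterDeletion G G' {s(x, y), s(y, z)} {x, y, z} (d + 2)

/-!
The graph `G'` is a subgraph of the cone over `G`, the graph obtained from `G` by joining a new
vertex `w` to every vertex. It therefore suffices to know that coning raises the dimension in which
a graph is independent by one.

For the coning step, take an independent realisation `p` of `G` in `ℝᵈ`, put the apex `w` at the
origin of `ℝᵈ⁺¹` and every old vertex `v` at `(p v, 1)`. In the last coordinate of the columns of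
the old vertices, the rows of old edges vanish, while the row of the spoke from `w` to `v` is the
unit vector of `v`. So the spokes are independent modulo the old edges, and the rows of the old
edges project onto their rows at `p`, which are independent
(`linearIndepOn_rigidityRow_coneRealisation`).

This realisation is not generic. However, the rows of a real matrix are independent exactly when its
Gram determinant is nonzero, and that determinant is a rational polynomial in the coordinates of the
realisation. As it does not vanish at one realisation, it is a nonzero polynomial, and hence does
not vanish at any generic one (`IsGenericRealisation.linearIndepOn_rigidityRow`). Generic
realisations exist because `ℝ` is uncountable and so has an infinite transcendence basis over `ℚ`.
-/

theorem rigidityRow_mk_apply {V : Type*} [DecidableEq V] {d : ℕ}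
    (p : V → EuclideanSpace ℝ (Fin d)) (u v : V) (c : V × Fin d) :
    rigidityRow p s(u, v) c = if c.1 = u then p u c.2 - p v c.2
      else if c.1 = v then p v c.2 - p u c.2 else 0 := by
  simp only [rigidityRow, Sym2.lift_mk]

theorem isRigidityIndependent_iff {V : Type*} {d : ℕ} {G : SimpleGraph V} :
    IsRigidityIndependent d G ↔ ∃ p : V → EuclideanSpace ℝ (Fin d), IsGenericRealisation p ∧
      LinearIndepOn ℝ (rigidityRow p) G.edgeSet := by
  simp only [IsRigidityIndependent, RigidityMatroidIndep, linearIndepOn_univ_iff]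
  rfl

theorem exists_algebraicIndependent_rat_real (ι : Type*) [Finite ι] :
    ∃ x : ι → ℝ, AlgebraicIndependent ℚ x := by
  obtain ⟨κ, y, hy⟩ := exists_isTranscendenceBasis' ℚ ℝ
  have hκ : Infinite κ := by
    by_contra hfin
    rw [not_infinite_iff_finite] at hfin
    have hcard : Cardinal.mk ℝ ≤ Cardinal.aleph0 := by
      rcases isEmpty_or_nonempty κ with h | h
      · have : Algebra.IsAlgebraic ℚ ℝ := hy.isEmpty_iff_isAlgebraic.1 h
        simpa using Algebra.IsAlgebraic.cardinalMk_le_max ℚ ℝ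
      · have := hy.lift_cardinalMk_eq_max_lift
        simp only [Cardinal.lift_id, Cardinal.mkRat] at this
        rw [this]
        simp [Cardinal.mk_le_aleph0]
    exact Cardinal.not_countable_real
      (Set.countable_univ_iff.2 (Cardinal.mk_le_aleph0_iff.1 hcard))
  obtain ⟨n, ⟨e⟩⟩ := Finite.exists_equiv_fin ι
  let f : ι ↪ κ := e.toEmbedding.trans (Fin.valEmbedding.trans (Infinite.natEmbedding κ))
  exact ⟨y ∘ f, hy.1.comp f f.injective⟩

theorem exists_isGenericRealisation (V : Type*) [Finite V] (d : ℕ) :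
    ∃ p : V → EuclideanSpace ℝ (Fin d), IsGenericRealisation p := by
  obtain ⟨x, hx⟩ := exists_algebraicIndependent_rat_real (V × Fin d)
  exact ⟨fun v => WithLp.toLp 2 fun i => x (v, i), hx⟩

theorem Matrix.linearIndependent_row_iff_det_mul_transpose_ne_zero {m n : Type*} [Fintype m]
    [DecidableEq m] [Fintype n] (A : Matrix m n ℝ) :
    LinearIndependent ℝ A.row ↔ (A * A.transpose).det ≠ 0 := by
  constructor
  · intro h
    have hrank : (A * A.transpose).rank = Fintype.card m := by
      rw [Matrix.rank_self_mul_transpose, h.rank_matrix]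
    rw [← isUnit_iff_ne_zero, ← Matrix.isUnit_iff_isUnit_det,
      ← Matrix.linearIndependent_rows_iff_isUnit, linearIndependent_iff_card_eq_finrank_span,
      Set.finrank, ← Matrix.rank_eq_finrank_span_row, hrank]
  · intro h
    rw [linearIndependent_iff_card_eq_finrank_span, Set.finrank,
      ← Matrix.rank_eq_finrank_span_row, ← Matrix.rank_self_mul_transpose,
      Matrix.rank_of_det_ne_zero h]

theorem exists_aeval_eq_rigidityRow {V : Type*} {d : ℕ} (e : Sym2 V) (c : V × Fin d) :
    ∃ f : MvPolynomial (V × Fin d) ℚ, ∀ p : V → EuclideanSpace ℝ (Fin d),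
      MvPolynomial.aeval (fun c : V × Fin d => p c.1 c.2) f = rigidityRow p e c := by
  classical
  induction e with
  | _ u v =>
    refine ⟨if c.1 = u then .X (u, c.2) - .X (v, c.2)
      else if c.1 = v then .X (v, c.2) - .X (u, c.2) else 0, fun p => ?_⟩
    rw [rigidityRow_mk_apply]
    split_ifs <;> simp

/-- Rows of the rigidity matrix that are independent at some realisation are independent at every
generic one: their Gram determinant is a rational polynomial in the coordinates. -/
theorem IsGenericRealisation.linearIndepOn_rigidityRow {V : Type*} [Finite V] {d : ℕ}
    {p q : V → EuclideanSpace ℝ (Fin d)} (hp : IsGenericRealisation p) {E : Set (Sym2 V)}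
    (hq : LinearIndepOn ℝ (rigidityRow q) E) : LinearIndepOn ℝ (rigidityRow p) E := by
  classical
  have := Fintype.ofFinite V
  have := Fintype.ofFinite E
  choose f hf using fun (e : Sym2 V) (c : V × Fin d) => exists_aeval_eq_rigidityRow e c
  let P : Matrix E (V × Fin d) (MvPolynomial (V × Fin d) ℚ) := Matrix.of fun e c => f e c
  let R (r : V → EuclideanSpace ℝ (Fin d)) : Matrix E (V × Fin d) ℝ :=
    Matrix.of fun e c => rigidityRow r e c
  have hgram (r : V → EuclideanSpace ℝ (Fin d)) :
      MvPolynomial.aeval (fun c : V × Fin d => r c.1 c.2) (P * P.transpose).det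
        = (R r * (R r).transpose).det := by
    rw [AlgHom.map_det]
    congr 1
    ext i j
    simp [P, R, Matrix.mul_apply, hf]
  have hdet : (P * P.transpose).det ≠ 0 := by
    intro h
    apply (R q).linearIndependent_row_iff_det_mul_transpose_ne_zero.1 hq
    rw [← hgram, h, map_zero]
  apply (R p).linearIndependent_row_iff_det_mul_transpose_ne_zero.2
  rw [← hgram]
  exact fun h => hdet (hp.eq_zero_of_aeval_eq_zero _ h)

/-- The realisation in `ℝᵈ⁺¹` of the cone over a framework in `ℝᵈ`: an old vertex `φ v` is placed
at `(p v, 1)`, everything outside the range of `φ` (in particular the apex) at the origin. -/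
noncomputable def coneRealisation {V V' : Type*} {d : ℕ} (φ : V ↪ V')
    (p : V → EuclideanSpace ℝ (Fin d)) (a : V') : EuclideanSpace ℝ (Fin (d + 1)) :=
  WithLp.toLp 2 (Function.extend φ (fun v => (Fin.snoc (p v) 1 : Fin (d + 1) → ℝ)) 0 a)

theorem coneRealisation_castSucc {V V' : Type*} {d : ℕ} (φ : V ↪ V')
    (p : V → EuclideanSpace ℝ (Fin d)) (v : V) (i : Fin d) :
    coneRealisation φ p (φ v) i.castSucc = p v i := by
  simp [coneRealisation, φ.injective.extend_apply]

theorem coneRealisation_last {V V' : Type*} {d : ℕ} (φ : V ↪ V')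
    (p : V → EuclideanSpace ℝ (Fin d)) (v : V) :
    coneRealisation φ p (φ v) (Fin.last d) = 1 := by
  simp [coneRealisation, φ.injective.extend_apply]

theorem coneRealisation_of_notMem_range {V V' : Type*} {d : ℕ} (φ : V ↪ V')
    (p : V → EuclideanSpace ℝ (Fin d)) {w : V'} (hw : w ∉ Set.range φ) :
    coneRealisation φ p w = 0 := by
  rw [coneRealisation, Function.extend_apply' _ _ _ hw]
  rfl

/-- Coning preserves independence, one dimension up. -/
theorem linearIndepOn_rigidityRow_coneRealisation {V V' : Type*} {d : ℕ} (φ : V ↪ V') {w : V'}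
    (hw : w ∉ Set.range φ) {p : V → EuclideanSpace ℝ (Fin d)} {E : Set (Sym2 V)}
    (hE : LinearIndepOn ℝ (rigidityRow p) E) :
    LinearIndepOn ℝ (rigidityRow (coneRealisation φ p))
      (Sym2.map φ '' E ∪ Set.range fun v => s(w, φ v)) := by
  classical
  have hne (v : V) : φ v ≠ w := fun h => hw ⟨v, h⟩
  -- `L` reads off the last coordinates at the old vertices, `M` the remaining ones.
  let L : (V' × Fin (d + 1) → ℝ) →ₗ[ℝ] (V → ℝ) :=
    LinearMap.funLeft ℝ ℝ fun v => (φ v, Fin.last d)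
  let M : (V' × Fin (d + 1) → ℝ) →ₗ[ℝ] (V × Fin d → ℝ) :=
    LinearMap.funLeft ℝ ℝ fun c => (φ c.1, c.2.castSucc)
  have hM : M ∘ rigidityRow (coneRealisation φ p) ∘ Sym2.map φ = rigidityRow p := by
    ext e c
    induction e with
    | _ a b =>
      simp [M, LinearMap.funLeft_apply, rigidityRow_mk_apply, coneRealisation_castSucc]
  have hLold (e : Sym2 V) : L (rigidityRow (coneRealisation φ p) (e.map φ)) = 0 := by
    ext v
    induction e with
    | _ a b =>
      simp [L, LinearMap.funLeft_apply, rigidityRow_mk_apply, coneRealisation_last]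
  have hLspoke : L ∘ rigidityRow (coneRealisation φ p) ∘ (fun v => s(w, φ v))
      = fun v => Pi.single v (1 : ℝ) := by
    ext v u
    by_cases huv : u = v
    · subst huv
      simp [L, LinearMap.funLeft_apply, rigidityRow_mk_apply, coneRealisation_last, hne,
        coneRealisation_of_notMem_range φ p hw]
    · simp [L, LinearMap.funLeft_apply, rigidityRow_mk_apply, hne, huv]
  have hspoke : LinearIndependent ℝ
      (L ∘ rigidityRow (coneRealisation φ p) ∘ fun v => s(w, φ v)) := by
    rw [hLspoke]
    exact Pi.linearIndependent_single_one V ℝ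
  refine LinearIndepOn.union ?_ ?_ ?_
  · apply LinearIndepOn.image_of_comp
    rw [← hM] at hE
    exact LinearIndependent.of_comp M hE
  · rw [← Set.image_univ]
    apply LinearIndepOn.image_of_comp
    rw [linearIndepOn_univ_iff]
    exact LinearIndependent.of_comp L hspoke
  · have hdisj := Submodule.range_ker_disjoint hspoke
    rw [Set.range_comp] at hdisj
    refine (hdisj.mono_right (Submodule.span_le.2 ?_)).symm
    rintro _ ⟨_, ⟨e, -, rfl⟩, rfl⟩
    exact hLold e

/-- The new graph is a subgraph of the cone over `G`, so it is independent one dimension up. -/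
theorem IsVertexAdditionAfterDeletion.isRigidityIndependent {V V' : Type*} [Finite V'] {d k : ℕ}
    {G : SimpleGraph V} {G' : SimpleGraph V'} {D : Set (Sym2 V)} {S : Set V}
    (h : IsVertexAdditionAfterDeletion G G' D S k) (hG : IsRigidityIndependent d G) :
    IsRigidityIndependent (d + 1) G' := by
  obtain ⟨φ, w, hφ, hadj, -, -⟩ := h
  obtain ⟨p, -, hp⟩ := isRigidityIndependent_iff.1 hG
  obtain ⟨q, hq⟩ := exists_isGenericRealisation V' (d + 1)
  have hw : w ∉ Set.range φ := by simp [hφ]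
  have hold (a : V') (ha : a ≠ w) : ∃ v, φ v = a := by
    rw [← Set.mem_range, hφ]
    exact ha
  refine isRigidityIndependent_iff.2 ⟨q, hq, hq.linearIndepOn_rigidityRow
    ((linearIndepOn_rigidityRow_coneRealisation φ hw hp).mono fun e => ?_)⟩
  induction e with
  | _ a b =>
    intro hab
    rw [SimpleGraph.mem_edgeSet] at hab
    by_cases ha : a = w
    · subst ha
      obtain ⟨v, rfl⟩ := hold b hab.ne'
      exact Or.inr ⟨v, rfl⟩
    by_cases hb : b = w
    · subst hb
      obtain ⟨v, rfl⟩ := hold a ha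
      exact Or.inr ⟨v, Sym2.eq_swap⟩
    obtain ⟨u, rfl⟩ := hold a ha
    obtain ⟨v, rfl⟩ := hold b hb
    exact Or.inl ⟨s(u, v), G.deleteEdges_le D ((hadj u v).1 hab), rfl⟩

theorem mainTheorem7 {V V' : Type*} [Finite V] [Finite V'] (d : ℕ)
    (G : SimpleGraph V) (G' : SimpleGraph V')
    (hG : IsRigidityIndependent d G)
    (hG' : IsXReplacement (d + 1) G G' ∨ IsVReplacement (d + 1) G G') :
    IsRigidityIndependent (d + 1) G' := by
  rcases hG' with ⟨_, _, _, _, -, -, -, -, -, -, h⟩ | ⟨_, _, _, -, -, -, h⟩ <;>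
    exact h.isRigidityIndependent hG
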